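/- **Corollary (Robust estimator for $p$).** Fix $p\in(0,1)$. For $r>0$ let $\mathrm{NegBin}(r,p)$ denote the distribution on $\{0,1,2,\dots\}$ with probability mass function $$P_{r,p}(k)=\frac{\Gamma(r+k)}{\Gamma(r)\,k!}\,(1-p)^r p^k .$$ For every $r>0$, let $K_1,K_2,\dots\sim\mathrm{NegBin}(r,p)$ and $U_1,U_2,\dots\sim\mathrm{Uniform}(0,1)$ be mutually independent random variables, defined on a probability space with probability measure $\mathbb P_r$, and put $X_i=K_i+U_i$. For each $n$ let $\hat m_{n,r}$ be a sample median of $X_1,\dots,X_n$, that is, any number such that at least half of the $X_i$ ($i\le n$) are $\le\hat m_{n,r}$ and at least half of them are $\ge\hat m_{n,r}$. Define $$\hat p_{n,r}=\frac{\hat m_{n,r}-\frac13}{\hat m_{n,r}-\frac23+r}.$$ Then $\hat p_{n,r}$ converges in probability to $p$ as $n\to\infty$ and then $r\to\infty$ (over the positive reals), in the following sense: 1. there is a function $c:\mathbb R\to\mathbb R$ such that, for all sufficiently large $r$, $\hat p_{n,r}\to c(r)$ in $\mathbb P_r$-probability as $n\to\infty$, and $c(r)\to p$ as $r\to\infty$;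 2. for every $\varepsilon>0$, $\displaystyle\lim_{r\to\infty}\,\limsup_{n\to\infty}\,\mathbb P_r\big(|\hat p_{n,r}-p|\ge\varepsilon\big)=0$. (If the sample medians are chosen non-measurably, $\mathbb P_r$ is read as outer probability.) -/

import Mathlib

open MeasureTheory ProbabilityTheory Filter Topology

/-- The probability mass function of the negative binomial distribution `NegBin(r, p)`:
`P(K = k) = Γ(r + k) / (Γ(r) k!) * (1 - p)^r * p^k` for `k = 0, 1, 2, …`. -/
noncomputable def negBinPMFReal (r p : ℝ) (k : ℕ) : ℝ :=
  Real.Gamma (r + k) / (Real.Gamma r * (k.factorial : ℝ)) * (1 - p) ^ r * p ^ k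

/-- The negative binomial distribution `NegBin(r, p)` as a measure on `ℕ`. -/
noncomputable def negBinMeasure (r p : ℝ) : Measure ℕ :=
  Measure.sum (fun k : ℕ => ENNReal.ofReal (negBinPMFReal r p k) • Measure.dirac k)

/-- `(K 0, U 0), (K 1, U 1), …` are independent pairs on `(Ω, P)`, and in each pair
`K i ∼ NegBin(r, p)` and `U i ∼ Uniform(0, 1)` are independent. Equivalently: all the variables
`K i`, `U j` are mutually independent, with these laws. -/
structure IsNegBinUniformSample {Ω : Type*} [MeasurableSpace Ω] (P : Measure Ω) (r p : ℝ)
    (K : ℕ → Ω → ℕ) (U : ℕ → Ω → ℝ) : Prop where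
  hasLaw_K : ∀ i, HasLaw (K i) (negBinMeasure r p) P
  hasLaw_U : ∀ i, pdf.IsUniform (U i) (Set.Ioo (0 : ℝ) 1) P volume
  indep_pair : ∀ i, IndepFun (K i) (U i) P
  indep_pairs : iIndepFun (fun i ω => (K i ω, U i ω)) P

/-- `m` is a sample median of `x₁, …, xₙ`: at least half of the observations are `≤ m` and at least
half of them are `≥ m`. For odd `n` this is the middle order statistic; for even `n` it is any
point between the two middle order statistics, so that every usual convention (lower median
`inf {t : Fₙ(t) ≥ 1/2}`, upper median, midpoint) is covered. -/
def IsSampleMedian {n : ℕ} (x : Fin n → ℝ) (m : ℝ) : Prop :=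
  n ≤ 2 * (Finset.univ.filter (fun i => x i ≤ m)).card ∧
  n ≤ 2 * (Finset.univ.filter (fun i => m ≤ x i)).card

/-- The plug-in estimator `(m - 1/3) / (m - 2/3 + r)` of `p`, where `m` is a sample median. -/
noncomputable def robustEstimator (r m : ℝ) : ℝ :=
  (m - 1 / 3) / (m - 2 / 3 + r)

/-!
Adding `U` to `K` spreads the negative binomial law over `[0, ∞)` so that it charges every
interval there; hence it has exactly one median `c_r`, and the law of large numbers, applied to
indicators of half-lines on either side of `c_r`, makes every choice of sample medians converge to
`c_r` in probability. With `q = p / (1 - p)` the law has mean `r q + 1/2` and variance at most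
`r q (1 + q) + 1/4`. By Chebyshev's inequality a median lies within `√(2 Var)` of the mean, which
is `O(√r)` here. Thus `c_r / r → q`, and the estimator tends to `q / (q + 1) = p`.
-/

open Set

/-! ### Medians of a probability measure -/

/-- A median of the law `μ`: both closed half-lines bounded by `c` have mass at least `1 / 2`. -/
def IsMedian (μ : Measure ℝ) (c : ℝ) : Prop :=
  1 / 2 ≤ μ.real (Iic c) ∧ 1 / 2 ≤ μ.real (Ici c)

/-- The lower median `inf {t : F(t) ≥ 1/2}` of the law `μ` with distribution function `F`. -/
noncomputable def lowerMedian (μ : Measure ℝ) : ℝ :=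
  sInf {t | 1 / 2 ≤ cdf μ t}

theorem isMedian_lowerMedian (μ : Measure ℝ) [IsProbabilityMeasure μ] :
    IsMedian μ (lowerMedian μ) := by
  set S : Set ℝ := {t | 1 / 2 ≤ cdf μ t}
  have hne : S.Nonempty :=
    ((tendsto_cdf_atTop μ).eventually_const_le (by norm_num : (1 / 2 : ℝ) < 1)).exists
  obtain ⟨b, hb⟩ :=
    ((tendsto_cdf_atBot μ).eventually_lt_const (by norm_num : (0 : ℝ) < 1 / 2)).exists
  have hbdd : BddBelow S :=
    ⟨b, fun t ht => le_of_not_gt fun htb => (ht.trans (monotone_cdf μ htb.le)).not_gt hb⟩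
  have hright : ∀ t > lowerMedian μ, 1 / 2 ≤ cdf μ t := fun t ht => by
    obtain ⟨u, hu, hut⟩ := exists_lt_of_csInf_lt hne ht
    exact le_trans hu (monotone_cdf μ hut.le)
  have hleft : ∀ t < lowerMedian μ, cdf μ t ≤ 1 / 2 := fun t ht => by
    have hmem : t ∉ S := notMem_of_lt_csInf ht hbdd
    exact (lt_of_not_ge hmem).le
  constructor
  · rw [← cdf_eq_real]
    exact ge_of_tendsto (((cdf μ).right_continuous _).tendsto.mono_left
      (nhdsWithin_mono _ Ioi_subset_Ici_self)) (eventually_mem_nhdsWithin.mono hright)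
  · have hlim : Function.leftLim (cdf μ) (lowerMedian μ) ≤ 1 / 2 :=
      le_of_tendsto ((monotone_cdf μ).tendsto_leftLim _) (eventually_mem_nhdsWithin.mono hleft)
    rw [measureReal_def, ← measure_cdf μ, StieltjesFunction.measure_Ici _ (tendsto_cdf_atTop μ),
      measure_cdf, ENNReal.toReal_ofReal (by linarith)]
    linarith

namespace IsMedian

variable {μ : Measure ℝ} {a b c : ℝ}

theorem measureReal_Iic_lt_half [IsFiniteMeasure μ] (hc : IsMedian μ c)
    (huniq : ∀ m, IsMedian μ m → m = c) (hac : a < c) : μ.real (Iic a) < 1 / 2 := by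
  by_contra! ha
  exact hac.ne (huniq a ⟨ha, hc.2.trans (measureReal_mono (Ici_subset_Ici.2 hac.le))⟩)

theorem measureReal_Ici_lt_half [IsFiniteMeasure μ] (hc : IsMedian μ c)
    (huniq : ∀ m, IsMedian μ m → m = c) (hcb : c < b) : μ.real (Ici b) < 1 / 2 := by
  by_contra! hb
  exact hcb.ne' (huniq b ⟨hc.1.trans (measureReal_mono (Iic_subset_Iic.2 hcb.le)), hb⟩)

theorem measure_Ioo_eq_zero [IsProbabilityMeasure μ] (ha : IsMedian μ a) (hb : IsMedian μ b) :
    μ (Ioo a b) = 0 := by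
  rcases le_or_gt b a with hba | hab
  · simp [Ioo_eq_empty hba.not_gt]
  have hIio : μ.real (Iic a) + μ.real (Ioo a b) = μ.real (Iio b) := by
    rw [← Iic_union_Ioo_eq_Iio hab, measureReal_union _ measurableSet_Ioo]
    exact disjoint_left.2 fun x hx hx' => hx'.1.not_ge hx
  have htotal : μ.real (Iio b) + μ.real (Ici b) = 1 := by
    rw [← compl_Iio, probReal_add_probReal_compl measurableSet_Iio]
  rw [← measureReal_eq_zero_iff]
  linarith [ha.1, hb.2, measureReal_nonneg (μ := μ) (s := Ioo a b)]

theorem le_of_measure_Iio_eq_zero (hc : IsMedian μ c) (ha : μ (Iio a) = 0) : a ≤ c := by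
  by_contra! hca
  have hzero : μ.real (Iic c) = 0 := by
    rw [measureReal_def, measure_mono_null (Iic_subset_Iio.2 hca) ha, ENNReal.toReal_zero]
  linarith [hc.1]

theorem eq_of_forall_measure_Ioo_ne_zero [IsProbabilityMeasure μ] {x m : ℝ} (hm : IsMedian μ m)
    (hc : IsMedian μ c) (hx : μ (Iio x) = 0) (hpos : ∀ a b, x ≤ a → a < b → μ (Ioo a b) ≠ 0) :
    m = c := by
  by_contra! hne
  rcases hne.lt_or_gt with hlt | hlt
  · exact hpos m c (hm.le_of_measure_Iio_eq_zero hx) hlt (hm.measure_Ioo_eq_zero hc)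
  · exact hpos c m (hc.le_of_measure_Iio_eq_zero hx) hlt (hc.measure_Ioo_eq_zero hm)

theorem sq_sub_mean_le_two_mul_variance [IsProbabilityMeasure μ] (hc : IsMedian μ c)
    (hμ : MemLp id 2 μ) : (c - ∫ x, x ∂μ) ^ 2 ≤ 2 * Var[id; μ] := by
  rcases eq_or_ne c (∫ x, x ∂μ) with heq | hne
  · simp [heq, variance_nonneg]
  have hdev : 0 < |c - ∫ x, x ∂μ| := abs_pos.2 (sub_ne_zero.2 hne)
  have hhalf : 1 / 2 ≤ μ.real {x | |c - ∫ x, x ∂μ| ≤ |x - ∫ x, x ∂μ|} := by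
    rcases hne.lt_or_gt with hlt | hgt
    · refine hc.1.trans (measureReal_mono fun x (hx : x ≤ c) => ?_)
      simp only [mem_ofPred_eq]
      rw [abs_of_neg (sub_neg.2 hlt), abs_of_neg (by linarith)]
      linarith
    · refine hc.2.trans (measureReal_mono fun x (hx : c ≤ x) => ?_)
      simp only [mem_ofPred_eq]
      rw [abs_of_pos (sub_pos.2 hgt), abs_of_pos (by linarith)]
      linarith
  have hchebyshev : μ.real {x | |c - ∫ x, x ∂μ| ≤ |x - ∫ x, x ∂μ|} ≤
      Var[id; μ] / |c - ∫ x, x ∂μ| ^ 2 :=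
    ENNReal.toReal_le_of_le_ofReal (div_nonneg (variance_nonneg _ _) (sq_nonneg _))
      (meas_ge_le_variance_div_sq hμ hdev)
  have h := (le_div_iff₀ (by positivity)).1 (hhalf.trans hchebyshev)
  rw [sq_abs] at h
  linarith

end IsMedian

/-! ### Convergence in measure to a constant -/

section TendstoInMeasureConst

variable {ι Ω E F : Type*} [MeasurableSpace Ω] [PseudoEMetricSpace E] [PseudoEMetricSpace F]
  {P : Measure Ω} {l : Filter ι}

theorem tendstoInMeasure_const_iff {f : ι → Ω → E} {c : E} :
    TendstoInMeasure P f l (fun _ => c) ↔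
      ∀ s ∈ 𝓝 c, Tendsto (fun i => P {ω | f i ω ∉ s}) l (𝓝 0) := by
  constructor
  · intro hf s hs
    obtain ⟨ε, hε, hball⟩ := EMetric.mem_nhds_iff.1 hs
    refine tendsto_of_tendsto_of_tendsto_of_le_of_le tendsto_const_nhds (hf ε hε)
      (fun _ => zero_le) fun i => measure_mono fun ω hω => ?_
    exact not_lt.1 fun hlt => hω (hball (Metric.mem_eball.2 hlt))
  · intro hf ε hε
    simpa using hf _ (Metric.eball_mem_nhds c hε)

theorem tendstoInMeasure_const_comp {f : ι → Ω → E} {c : E} {g : E → F}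
    (hf : TendstoInMeasure P f l (fun _ => c)) (hg : ContinuousAt g c) :
    TendstoInMeasure P (fun i ω => g (f i ω)) l (fun _ => g c) :=
  tendstoInMeasure_const_iff.2 fun s hs => tendstoInMeasure_const_iff.1 hf (g ⁻¹' s) (hg hs)

end TendstoInMeasureConst

theorem tendsto_limsup_measure_notMem {κ ι E : Type*} [PseudoEMetricSpace E] {Ω : κ → Type*}
    [∀ r, MeasurableSpace (Ω r)] {P : ∀ r, Measure (Ω r)} {k : Filter κ} {l : Filter ι} [l.NeBot]
    {f : ∀ r, ι → Ω r → E} {c : κ → E} {x : E}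
    (hf : ∀ᶠ r in k, TendstoInMeasure (P r) (f r) l (fun _ => c r)) (hc : Tendsto c k (𝓝 x))
    {s : Set E} (hs : s ∈ 𝓝 x) :
    Tendsto (fun r => limsup (fun i => P r {ω | f r i ω ∉ s}) l) k (𝓝 0) := by
  refine tendsto_const_nhds.congr' ?_
  filter_upwards [hf, hc.eventually (eventually_mem_nhds_iff.2 hs)] with r hfr hsr
  exact (tendstoInMeasure_const_iff.1 hfr s hsr).limsup_eq.symm

/-! ### Consistency of sample medians -/

section SampleMedian

variable {Ω E : Type*} [MeasurableSpace Ω] [MeasurableSpace E] {P : Measure Ω}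
  [IsProbabilityMeasure P]

theorem tendstoInMeasure_frequency {μ : Measure E} {X : ℕ → Ω → E}
    (hlaw : ∀ i, HasLaw (X i) μ P) (hindep : Pairwise fun i j => IndepFun (X i) (X j) P)
    {s : Set E} [DecidablePred (· ∈ s)] (hs : MeasurableSet s) :
    TendstoInMeasure P
      (fun (n : ℕ) ω => ((Finset.univ.filter fun i : Fin n => X i ω ∈ s).card : ℝ) / n) atTop
      (fun _ => μ.real s) := by
  set g : E → ℝ := s.indicator 1
  have hg : Measurable g := measurable_one.indicator hs
  have hgX (i : ℕ) : AEMeasurable (g ∘ X i) P := hg.comp_aemeasurable (hlaw i).aemeasurable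
  have hint : Integrable (g ∘ X 0) P :=
    Integrable.of_bound (hgX 0).aestronglyMeasurable 1 <| ae_of_all _ fun ω => by
      by_cases h : X 0 ω ∈ s <;> simp [g, h]
  have hmean : ∫ ω, (g ∘ X 0) ω ∂P = μ.real s := by
    rw [(hlaw 0).integral_comp hg.aestronglyMeasurable, integral_indicator_one hs]
  have hcard (n : ℕ) (ω : Ω) : ∑ i ∈ Finset.range n, (g ∘ X i) ω =
      ((Finset.univ.filter fun i : Fin n => X i ω ∈ s).card : ℝ) := by
    rw [Finset.sum_range, Finset.card_filter]
    push_cast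
    exact Finset.sum_congr rfl fun i _ => by simp [g, indicator_apply]
  have hslln := strong_law_ae_real (fun i => g ∘ X i) hint
    (fun i j hij => (hindep hij).comp hg hg) fun i => ((hlaw i).identDistrib (hlaw 0)).comp hg
  simp only [hmean, hcard] at hslln
  refine tendstoInMeasure_of_tendsto_ae (fun n => ?_) hslln
  simp only [← hcard]
  exact ((Finset.aemeasurable_fun_sum _ fun i _ => hgX i).div_const _).aestronglyMeasurable

theorem tendsto_measure_le_two_mul_card {μ : Measure E} {X : ℕ → Ω → E}
    (hlaw : ∀ i, HasLaw (X i) μ P) (hindep : Pairwise fun i j => IndepFun (X i) (X j) P)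
    {s : Set E} [DecidablePred (· ∈ s)] (hs : MeasurableSet s) (hlt : μ.real s < 1 / 2) :
    Tendsto (fun n : ℕ => P {ω | n ≤ 2 * (Finset.univ.filter fun i : Fin n => X i ω ∈ s).card})
      atTop (𝓝 0) := by
  have hfreq := tendstoInMeasure_const_iff.1 (tendstoInMeasure_frequency hlaw hindep hs) _
    (Iio_mem_nhds hlt)
  refine tendsto_of_tendsto_of_tendsto_of_le_of_le' tendsto_const_nhds hfreq
    (Eventually.of_forall fun _ => zero_le) ?_
  filter_upwards [eventually_gt_atTop 0] with n hn
  refine measure_mono fun ω (hω : n ≤ 2 * _) => ?_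
  have hω' : (n : ℝ) ≤ 2 * ((Finset.univ.filter fun i : Fin n => X i ω ∈ s).card : ℝ) := by
    exact_mod_cast hω
  rw [mem_ofPred_eq, mem_Iio, not_lt, le_div_iff₀ (by exact_mod_cast hn)]
  linarith

theorem tendstoInMeasure_sampleMedian {μ : Measure ℝ} {X : ℕ → Ω → ℝ}
    (hlaw : ∀ i, HasLaw (X i) μ P) (hindep : Pairwise fun i j => IndepFun (X i) (X j) P)
    {c : ℝ} (hc : IsMedian μ c) (huniq : ∀ m, IsMedian μ m → m = c)
    {M : ℕ → Ω → ℝ} (hM : ∀ n ω, IsSampleMedian (fun i : Fin n => X i ω) (M n ω)) :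
    TendstoInMeasure P M atTop (fun _ => c) := by
  have : IsProbabilityMeasure μ := (hlaw 0).isProbabilityMeasure_iff.1 ‹_›
  refine tendstoInMeasure_const_iff.2 fun s hs => ?_
  obtain ⟨a, b, ⟨hac, hcb⟩, hsub⟩ := mem_nhds_iff_exists_Ioo_subset.1 hs
  have hlow := tendsto_measure_le_two_mul_card hlaw hindep measurableSet_Iic
    (hc.measureReal_Iic_lt_half huniq hac)
  have hhigh := tendsto_measure_le_two_mul_card hlaw hindep measurableSet_Ici
    (hc.measureReal_Ici_lt_half huniq hcb)
  refine tendsto_of_tendsto_of_tendsto_of_le_of_le tendsto_const_nhds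
    (by simpa using hlow.add hhigh) (fun _ => zero_le) fun n =>
      (measure_mono fun ω (hω : M n ω ∉ s) => ?_).trans (measure_union_le _ _)
  rcases le_or_gt (M n ω) a with hMa | hMa
  · exact .inl <| (hM n ω).1.trans <| Nat.mul_le_mul_left _ <| Finset.card_le_card <|
      Finset.monotone_filter_right _ fun i _ hi => hi.trans hMa
  · have hbM : b ≤ M n ω := not_lt.1 fun hMb => hω (hsub ⟨hMa, hMb⟩)
    exact .inr <| (hM n ω).2.trans <| Nat.mul_le_mul_left _ <| Finset.card_le_card <|
      Finset.monotone_filter_right _ fun i _ hi => hbM.trans hi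

end SampleMedian

/-! ### Jittering a law on `ℕ` by a uniform variable -/

section Conv

variable {μ ν : Measure ℝ}

theorem memLp_id_conv [IsFiniteMeasure μ] [IsFiniteMeasure ν] {s : ENNReal} (hμ : MemLp id s μ)
    (hν : MemLp id s ν) : MemLp id s (μ ∗ ν) :=
  (memLp_map_measure_iff (by fun_prop) (by fun_prop)).2 ((hμ.comp_fst ν).add (hν.comp_snd μ))

theorem integral_id_conv [IsProbabilityMeasure μ] [IsProbabilityMeasure ν] (hμ : Integrable id μ)
    (hν : Integrable id ν) : ∫ x, x ∂(μ ∗ ν) = ∫ x, x ∂μ + ∫ x, x ∂ν := by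
  rw [Measure.conv, integral_map (by fun_prop) (by fun_prop)]
  refine (integral_add (hμ.comp_fst ν) (hν.comp_snd μ)).trans ?_
  simp [integral_fun_fst (fun x : ℝ => x), integral_fun_snd (fun x : ℝ => x)]

theorem variance_id_conv [IsProbabilityMeasure μ] [IsProbabilityMeasure ν] (hμ : MemLp id 2 μ)
    (hν : MemLp id 2 ν) : Var[id; μ ∗ ν] = Var[id; μ] + Var[id; ν] := by
  rw [Measure.conv, variance_map (by fun_prop) (by fun_prop), ← variance_add_prod hμ hν]
  rfl

theorem conv_Iio_add_eq_zero [SFinite ν] {a b : ℝ} (hμ : μ (Iio a) = 0)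
    (hν : ν (Iio b) = 0) : (μ ∗ ν) (Iio (a + b)) = 0 := by
  rw [Measure.conv, Measure.map_apply (by fun_prop) measurableSet_Iio]
  refine measure_mono_null (t := Iio a ×ˢ univ ∪ univ ×ˢ Iio b)
    (fun x (hx : x.1 + x.2 < a + b) => ?_) (by simp [hμ, hν])
  simpa using lt_or_lt_of_add_lt_add hx

end Conv

/-- The law of `K + U` for independent `K` with law `μ` and `U` uniform on `(0, 1)`. -/
noncomputable def uniformJitter (μ : Measure ℕ) : Measure ℝ :=
  μ.map (↑) ∗ volume.restrict (Ioo 0 1)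

instance isProbabilityMeasure_volume_restrict_Ioo_zero_one :
    IsProbabilityMeasure (volume.restrict (Ioo (0 : ℝ) 1)) :=
  ⟨by simp⟩

theorem memLp_id_volume_restrict_Ioo_zero_one (s : ENNReal) :
    MemLp id s (volume.restrict (Ioo (0 : ℝ) 1)) :=
  MemLp.of_bound aestronglyMeasurable_id 1 <| ae_restrict_of_forall_mem measurableSet_Ioo
    fun x hx => by simpa [abs_of_pos hx.1] using hx.2.le

theorem integral_id_Ioo_zero_one : ∫ x in Ioo (0 : ℝ) 1, x = 1 / 2 := by
  rw [← integral_Ioc_eq_integral_Ioo, ← intervalIntegral.integral_of_le zero_le_one, integral_id]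
  norm_num

section UniformJitter

variable {μ : Measure ℕ}

instance isProbabilityMeasure_map_natCast [IsProbabilityMeasure μ] :
    IsProbabilityMeasure (μ.map ((↑) : ℕ → ℝ)) :=
  Measure.isProbabilityMeasure_map (by fun_prop)

instance isProbabilityMeasure_uniformJitter [IsProbabilityMeasure μ] :
    IsProbabilityMeasure (uniformJitter μ) := by
  unfold uniformJitter
  infer_instance

theorem uniformJitter_Iio_zero : uniformJitter μ (Iio 0) = 0 := by
  have hnat : μ.map ((↑) : ℕ → ℝ) (Iio 0) = 0 := by
    rw [Measure.map_apply (by fun_prop) measurableSet_Iio]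
    simp [preimage, (Nat.cast_nonneg _).not_gt]
  have hunif : volume.restrict (Ioo (0 : ℝ) 1) (Iio 0) = 0 := by
    rw [Measure.restrict_apply measurableSet_Iio]
    simp [Iio_inter_Ioo]
  simpa [uniformJitter] using conv_Iio_add_eq_zero hnat hunif

theorem uniformJitter_Ioo_ne_zero (hμ : ∀ k, μ {k} ≠ 0) {a b : ℝ} (ha : 0 ≤ a) (hab : a < b) :
    uniformJitter μ (Ioo a b) ≠ 0 := by
  set k := ⌊a⌋₊
  have hka : (k : ℝ) ≤ a := Nat.floor_le ha
  have hak : a < k + 1 := Nat.lt_floor_add_one a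
  set I : Set ℝ := Ioo (a - k) (min (b - k) 1)
  have hnat : μ.map ((↑) : ℕ → ℝ) {(k : ℝ)} ≠ 0 := by
    rw [Measure.map_apply (by fun_prop) (measurableSet_singleton _)]
    simpa [preimage] using hμ k
  have hunif : volume.restrict (Ioo (0 : ℝ) 1) I ≠ 0 := by
    rw [Measure.restrict_eq_self _ (Ioo_subset_Ioo (by linarith) (min_le_right _ _)),
      Real.volume_Ioo, ENNReal.ofReal_ne_zero_iff, sub_pos, lt_min_iff]
    constructor <;> linarith
  have hrect : {(k : ℝ)} ×ˢ I ⊆ (fun x : ℝ × ℝ => x.1 + x.2) ⁻¹' Ioo a b := by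
    rintro ⟨_, u⟩ ⟨rfl, hau, hub⟩
    have hub' : u < b - k := hub.trans_le (min_le_left _ _)
    constructor <;> simp only <;> linarith
  rw [uniformJitter, Measure.conv, Measure.map_apply (by fun_prop) measurableSet_Ioo]
  refine fun h => mul_ne_zero hnat hunif ?_
  rw [← Measure.prod_prod, measure_mono_null hrect h]

theorem memLp_id_map_natCast {s : ENNReal} (hμ : MemLp ((↑) : ℕ → ℝ) s μ) :
    MemLp id s (μ.map ((↑) : ℕ → ℝ)) :=
  (memLp_map_measure_iff (by fun_prop) (by fun_prop)).2 hμ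

theorem memLp_id_uniformJitter [IsFiniteMeasure μ] {s : ENNReal}
    (hμ : MemLp ((↑) : ℕ → ℝ) s μ) : MemLp id s (uniformJitter μ) :=
  memLp_id_conv (memLp_id_map_natCast hμ) (memLp_id_volume_restrict_Ioo_zero_one s)

theorem integral_id_uniformJitter [IsProbabilityMeasure μ] (hμ : Integrable ((↑) : ℕ → ℝ) μ) :
    ∫ x, x ∂uniformJitter μ = ∫ k, (k : ℝ) ∂μ + 1 / 2 := by
  rw [uniformJitter, integral_id_conv ((integrable_map_measure (by fun_prop) (by fun_prop)).2 hμ)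
    ((memLp_id_volume_restrict_Ioo_zero_one 2).integrable one_le_two), integral_id_Ioo_zero_one,
    integral_map (by fun_prop) (by fun_prop)]

theorem variance_id_uniformJitter_le [IsProbabilityMeasure μ]
    (hμ : MemLp ((↑) : ℕ → ℝ) 2 μ) :
    Var[id; uniformJitter μ] ≤ Var[((↑) : ℕ → ℝ); μ] + 1 / 4 := by
  have hpopoviciu : Var[id; volume.restrict (Ioo (0 : ℝ) 1)] ≤ ((1 - 0) / 2) ^ 2 :=
    variance_le_sq_of_bounded
      (ae_restrict_of_forall_mem measurableSet_Ioo fun _ hx => Ioo_subset_Icc_self hx)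
      aemeasurable_id
  rw [uniformJitter, variance_id_conv (memLp_id_map_natCast hμ)
    (memLp_id_volume_restrict_Ioo_zero_one 2), variance_map (by fun_prop) (by fun_prop),
    Function.id_comp]
  linarith

theorem hasLaw_add_uniformJitter [IsFiniteMeasure μ] {Ω : Type*} [MeasurableSpace Ω]
    {P : Measure Ω} {K : Ω → ℕ} {U : Ω → ℝ} (hK : HasLaw K μ P)
    (hU : pdf.IsUniform U (Ioo 0 1) P) (hKU : IndepFun K U P) :
    HasLaw (fun ω => (K ω : ℝ) + U ω) (uniformJitter μ) P := by
  have hcast : HasLaw (fun ω => (K ω : ℝ)) (μ.map (↑)) P :=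
    HasLaw.comp ⟨by fun_prop, rfl⟩ hK
  have hunif : HasLaw U (volume.restrict (Ioo 0 1)) P :=
    ⟨hU.aemeasurable (by simp) (by simp), by rw [hU]; simp [ProbabilityTheory.cond]⟩
  exact (hKU.comp (measurable_of_countable _) measurable_id).hasLaw_fun_add hcast hunif

theorem lowerMedian_uniformJitter_nonneg [IsProbabilityMeasure μ] :
    0 ≤ lowerMedian (uniformJitter μ) :=
  (isMedian_lowerMedian _).le_of_measure_Iio_eq_zero uniformJitter_Iio_zero

theorem eq_lowerMedian_uniformJitter [IsProbabilityMeasure μ] (hμ : ∀ k, μ {k} ≠ 0) {m : ℝ}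
    (hm : IsMedian (uniformJitter μ) m) : m = lowerMedian (uniformJitter μ) :=
  hm.eq_of_forall_measure_Ioo_ne_zero (isMedian_lowerMedian _) uniformJitter_Iio_zero
    fun _ _ => uniformJitter_Ioo_ne_zero hμ

theorem sq_lowerMedian_uniformJitter_sub_le [IsProbabilityMeasure μ]
    (hμ : MemLp ((↑) : ℕ → ℝ) 2 μ) :
    (lowerMedian (uniformJitter μ) - (∫ k, (k : ℝ) ∂μ + 1 / 2)) ^ 2 ≤
      2 * (Var[((↑) : ℕ → ℝ); μ] + 1 / 4) := by
  rw [← integral_id_uniformJitter (hμ.integrable one_le_two)]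
  exact ((isMedian_lowerMedian _).sq_sub_mean_le_two_mul_variance
    (memLp_id_uniformJitter hμ)).trans (by gcongr; exact variance_id_uniformJitter_le hμ)

end UniformJitter

/-! ### Moments of the negative binomial distribution -/

theorem gamma_add_natCast {r : ℝ} (hr : ∀ m : ℕ, r ≠ -m) (k : ℕ) :
    Real.Gamma (r + k) = Real.Gamma r * (ascPochhammer ℝ k).eval r := by
  induction k with
  | zero => simp
  | succ k ih =>
    have hrk : r + k ≠ 0 := fun h => hr k (eq_neg_of_add_eq_zero_left h)
    rw [Nat.cast_succ, ← add_assoc, Real.Gamma_add_one hrk, ih, ascPochhammer_succ_eval]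
    ring

section NegBin

variable {r p : ℝ}

theorem gamma_add_natCast_div_mul_one_sub_rpow_pos (hr : 0 < r) (hp : p < 1) (k : ℕ) :
    0 < Real.Gamma (r + k) / (Real.Gamma r * (k.factorial : ℝ)) * (1 - p) ^ r :=
  mul_pos (div_pos (Real.Gamma_pos_of_pos (by positivity))
    (mul_pos (Real.Gamma_pos_of_pos hr) (by positivity))) (Real.rpow_pos_of_pos (sub_pos.2 hp) r)

theorem negBinPMFReal_nonneg (hr : 0 < r) (hp : p ∈ Ico 0 1) (k : ℕ) : 0 ≤ negBinPMFReal r p k :=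
  mul_nonneg (gamma_add_natCast_div_mul_one_sub_rpow_pos hr hp.2 k).le (pow_nonneg hp.1 k)

theorem negBinPMFReal_pos (hr : 0 < r) (hp : p ∈ Ioo 0 1) (k : ℕ) : 0 < negBinPMFReal r p k :=
  mul_pos (gamma_add_natCast_div_mul_one_sub_rpow_pos hr hp.2 k) (pow_pos hp.1 k)

theorem negBinPMFReal_eq_choose (hr : 0 < r) (p : ℝ) (k : ℕ) :
    negBinPMFReal r p k = (1 - p) ^ r * (Ring.choose (r + k - 1) k * p ^ k) := by
  have hrm (m : ℕ) : r ≠ -m := by linarith [m.cast_nonneg (α := ℝ)]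
  have hΓ : Real.Gamma r ≠ 0 := Real.Gamma_ne_zero hrm
  have hchoose : (k.factorial : ℝ) * Ring.choose (r + k - 1) k = (ascPochhammer ℝ k).eval r := by
    rw [← Ring.multichoose_eq, ← nsmul_eq_mul, Ring.factorial_nsmul_multichoose_eq_ascPochhammer,
      Polynomial.ascPochhammer_smeval_eq_eval]
  rw [negBinPMFReal, gamma_add_natCast hrm, ← hchoose]
  field_simp

theorem hasSum_negBinPMFReal (hr : 0 < r) (hp : p ∈ Ico 0 1) : HasSum (negBinPMFReal r p) 1 := by
  have hpow : (1 - p) ^ r ≠ 0 := (Real.rpow_pos_of_pos (sub_pos.2 hp.2) r).ne'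
  have hmem : p ∈ Metric.eball (0 : ℝ) 1 := by
    simp [← ENNReal.ofReal_one, Metric.eball_ofReal, abs_of_nonneg hp.1, hp.2]
  have hbinomial : HasSum (fun k : ℕ => Ring.choose (r + k - 1) k * p ^ k) (1 / (1 - p) ^ r) := by
    simpa [FormalMultilinearSeries.ofScalars, mul_comm] using
      (Real.one_div_one_sub_rpow_hasFPowerSeriesOnBall_zero r).hasSum hmem
  simpa only [← negBinPMFReal_eq_choose hr, mul_one_div_cancel hpow] using
    hbinomial.mul_left ((1 - p) ^ r)

theorem succ_mul_negBinPMFReal_succ (hr : 0 < r) (hp : p < 1) (k : ℕ) :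
    ((k + 1 : ℕ) : ℝ) * negBinPMFReal r p (k + 1) =
      r * (p / (1 - p)) * negBinPMFReal (r + 1) p k := by
  have h1p : 1 - p ≠ 0 := (sub_pos.2 hp).ne'
  have hΓ : Real.Gamma r ≠ 0 := (Real.Gamma_pos_of_pos hr).ne'
  have hshift : r + ((k + 1 : ℕ) : ℝ) = r + 1 + k := by push_cast; ring
  rw [negBinPMFReal, negBinPMFReal, hshift, Real.Gamma_add_one hr.ne', Real.rpow_add_one h1p,
    Nat.factorial_succ, pow_succ]
  push_cast
  field_simp

theorem hasSum_descFactorial_mul_negBinPMFReal (hr : 0 < r) (hp : p ∈ Ico 0 1) (j : ℕ) :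
    HasSum (fun k => (k.descFactorial j : ℝ) * negBinPMFReal r p k)
      ((ascPochhammer ℝ j).eval r * (p / (1 - p)) ^ j) := by
  induction j generalizing r with
  | zero => simpa using hasSum_negBinPMFReal hr hp
  | succ j ih =>
    rw [← hasSum_nat_add_iff' 1]
    convert! (ih (add_pos hr one_pos)).mul_left (r * (p / (1 - p))) using 1
    · ext k
      rw [Nat.succ_descFactorial_succ, Nat.cast_mul, mul_right_comm,
        succ_mul_negBinPMFReal_succ hr hp.2]
      ring
    · simp only [ascPochhammer_succ_left, Polynomial.eval_mul, Polynomial.eval_X,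
        Polynomial.eval_comp, Polynomial.eval_add, Polynomial.eval_one, Finset.sum_range_one,
        Nat.zero_descFactorial_succ, Nat.cast_zero, zero_mul, sub_zero]
      ring

theorem isProbabilityMeasure_negBinMeasure (hr : 0 < r) (hp : p ∈ Ico 0 1) :
    IsProbabilityMeasure (negBinMeasure r p) :=
  (hasSum_negBinPMFReal hr hp).isProbabilityMeasure_sum_dirac (negBinPMFReal_nonneg hr hp)

theorem negBinMeasure_singleton_ne_zero (hr : 0 < r) (hp : p ∈ Ioo 0 1) (k : ℕ) :
    negBinMeasure r p {k} ≠ 0 := by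
  rw [negBinMeasure, Measure.sum_smul_dirac_singleton]
  exact (ENNReal.ofReal_pos.2 (negBinPMFReal_pos hr hp k)).ne'

theorem integrable_negBinMeasure_iff (hr : 0 < r) (hp : p ∈ Ico 0 1) {f : ℕ → ℝ} :
    Integrable f (negBinMeasure r p) ↔ Summable fun k => f k * negBinPMFReal r p k := by
  rw [negBinMeasure, integrable_sum_dirac_iff (by simp),
    ← summable_norm_iff (f := fun k => f k * _)]
  congrm Summable (fun k => ?_)
  rw [ENNReal.toReal_ofReal (negBinPMFReal_nonneg hr hp k), norm_mul, mul_comm,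
    Real.norm_of_nonneg (negBinPMFReal_nonneg hr hp k)]

theorem integral_negBinMeasure (hr : 0 < r) (hp : p ∈ Ico 0 1) (f : ℕ → ℝ) :
    ∫ k, f k ∂negBinMeasure r p = ∑' k, f k * negBinPMFReal r p k := by
  rw [negBinMeasure, integral_sum_dirac (by simp)]
  congr with k
  rw [ENNReal.toReal_ofReal (negBinPMFReal_nonneg hr hp k), smul_eq_mul, mul_comm]

theorem hasSum_natCast_mul_negBinPMFReal (hr : 0 < r) (hp : p ∈ Ico 0 1) :
    HasSum (fun k : ℕ => (k : ℝ) * negBinPMFReal r p k) (r * (p / (1 - p))) := by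
  simpa using hasSum_descFactorial_mul_negBinPMFReal hr hp 1

theorem hasSum_natCast_sq_mul_negBinPMFReal (hr : 0 < r) (hp : p ∈ Ico 0 1) :
    HasSum (fun k : ℕ => (k : ℝ) ^ 2 * negBinPMFReal r p k)
      (r * (r + 1) * (p / (1 - p)) ^ 2 + r * (p / (1 - p))) := by
  convert! (hasSum_descFactorial_mul_negBinPMFReal hr hp 2).add
    (hasSum_natCast_mul_negBinPMFReal hr hp) using 1
  · ext k
    rw [Nat.cast_descFactorial_two]
    ring
  · simp [ascPochhammer_succ_eval]

theorem memLp_natCast_negBinMeasure (hr : 0 < r) (hp : p ∈ Ico 0 1) :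
    MemLp ((↑) : ℕ → ℝ) 2 (negBinMeasure r p) := by
  rw [memLp_two_iff_integrable_sq (by fun_prop), integrable_negBinMeasure_iff hr hp]
  exact (hasSum_natCast_sq_mul_negBinPMFReal hr hp).summable

theorem integral_natCast_negBinMeasure (hr : 0 < r) (hp : p ∈ Ico 0 1) :
    ∫ k, (k : ℝ) ∂negBinMeasure r p = r * (p / (1 - p)) := by
  rw [integral_negBinMeasure hr hp, (hasSum_natCast_mul_negBinPMFReal hr hp).tsum_eq]

theorem variance_natCast_negBinMeasure (hr : 0 < r) (hp : p ∈ Ico 0 1) :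
    Var[((↑) : ℕ → ℝ); negBinMeasure r p] = r * (p / (1 - p)) * (1 + p / (1 - p)) := by
  have := isProbabilityMeasure_negBinMeasure hr hp
  rw [variance_eq_sub (memLp_natCast_negBinMeasure hr hp), integral_natCast_negBinMeasure hr hp]
  simp only [Pi.pow_apply]
  rw [integral_negBinMeasure hr hp, (hasSum_natCast_sq_mul_negBinPMFReal hr hp).tsum_eq]
  ring

end NegBin

/-! ### The limit of the estimator -/

theorem tendsto_div_of_sq_sub_le {m : ℝ → ℝ} {q a A B : ℝ}
    (hm : ∀ᶠ r in atTop, (m r - (r * q + a)) ^ 2 ≤ A * r + B) :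
    Tendsto (fun r => m r / r) atTop (𝓝 q) := by
  have hdiv (x : ℝ) : Tendsto (fun r => x / r) atTop (𝓝 0) := tendsto_id.const_div_atTop x
  have hbound : Tendsto (fun r : ℝ => √(A / r + B / r / r)) atTop (𝓝 0) := by
    simpa using ((hdiv A).add ((hdiv B).div_atTop tendsto_id)).sqrt
  have herror : Tendsto (fun r => (m r - (r * q + a)) / r) atTop (𝓝 0) := by
    refine squeeze_zero_norm' ?_ hbound
    filter_upwards [hm, eventually_gt_atTop 0] with r hmr hr
    refine Real.abs_le_sqrt ?_
    rw [div_pow, div_le_iff₀ (by positivity)]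
    refine hmr.trans_eq ?_
    field_simp
  have hsum := (herror.add (hdiv a)).add_const q
  simp only [zero_add] at hsum
  refine hsum.congr' ?_
  filter_upwards [eventually_ne_atTop 0] with r hr
  field_simp
  ring

theorem tendsto_robustEstimator {m : ℝ → ℝ} {q : ℝ} (hq : q + 1 ≠ 0)
    (hm : Tendsto (fun r => m r / r) atTop (𝓝 q)) :
    Tendsto (fun r => robustEstimator r (m r)) atTop (𝓝 (q / (q + 1))) := by
  have hdiv (x : ℝ) : Tendsto (fun r => x / r) atTop (𝓝 0) := tendsto_id.const_div_atTop x
  have hnum : Tendsto (fun r => m r / r - 1 / 3 / r) atTop (𝓝 q) := by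
    simpa using hm.sub (hdiv (1 / 3))
  have hden : Tendsto (fun r => m r / r - 2 / 3 / r + 1) atTop (𝓝 (q + 1)) := by
    simpa using (hm.sub (hdiv (2 / 3))).add_const 1
  refine (hnum.div hden hq).congr' ?_
  filter_upwards [eventually_ne_atTop 0] with r hr
  simp only [Pi.div_apply, robustEstimator]
  rw [← mul_div_mul_right _ (m r / r - 2 / 3 / r + 1) hr]
  congr 1 <;> field_simp

theorem continuousAt_robustEstimator {r m : ℝ} (hm : m - 2 / 3 + r ≠ 0) :
    ContinuousAt (robustEstimator r) m := by
  unfold robustEstimator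
  fun_prop (disch := exact hm)

theorem tendsto_robustEstimator_lowerMedian {p : ℝ} (hp : p ∈ Ico 0 1) :
    Tendsto (fun r => robustEstimator r (lowerMedian (uniformJitter (negBinMeasure r p)))) atTop
      (𝓝 p) := by
  have h1p : 1 - p ≠ 0 := (sub_pos.2 hp.2).ne'
  set q := p / (1 - p) with hq
  have hq1 : q + 1 = (1 - p)⁻¹ := by rw [hq]; field_simp; ring
  have hqp : q / (q + 1) = p := by rw [hq1, hq]; field_simp
  have hdev : ∀ᶠ r in atTop, (lowerMedian (uniformJitter (negBinMeasure r p)) -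
      (r * q + 1 / 2)) ^ 2 ≤ 2 * (q * (1 + q)) * r + 1 / 2 := by
    filter_upwards [eventually_gt_atTop 0] with r hr
    have := isProbabilityMeasure_negBinMeasure hr hp
    have h := sq_lowerMedian_uniformJitter_sub_le (memLp_natCast_negBinMeasure hr hp)
    rw [integral_natCast_negBinMeasure hr hp, variance_natCast_negBinMeasure hr hp] at h
    exact h.trans_eq (by ring)
  simpa only [hqp] using
    tendsto_robustEstimator (hq1 ▸ inv_ne_zero h1p) (tendsto_div_of_sq_sub_le hdev)

namespace IsNegBinUniformSample

variable {Ω : Type*} [MeasurableSpace Ω] {P : Measure Ω} {r p : ℝ} {K : ℕ → Ω → ℕ}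
  {U : ℕ → Ω → ℝ}

theorem pairwise_indepFun_add (h : IsNegBinUniformSample P r p K U) :
    Pairwise fun i j => IndepFun (fun ω => (K i ω : ℝ) + U i ω) (fun ω => (K j ω : ℝ) + U j ω) P :=
  have hadd : Measurable fun x : ℕ × ℝ => (x.1 : ℝ) + x.2 := by fun_prop
  fun _ _ hij => (h.indep_pairs.indepFun hij).comp hadd hadd

theorem tendstoInMeasure_robustEstimator [IsProbabilityMeasure P]
    (h : IsNegBinUniformSample P r p K U) (hr : 2 / 3 < r) (hp : p ∈ Ioo 0 1) {M : ℕ → Ω → ℝ}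
    (hM : ∀ n ω, IsSampleMedian (fun i : Fin n => (K i ω : ℝ) + U i ω) (M n ω)) :
    TendstoInMeasure P (fun n ω => robustEstimator r (M n ω)) atTop
      (fun _ => robustEstimator r (lowerMedian (uniformJitter (negBinMeasure r p)))) := by
  have hr0 : 0 < r := by linarith
  have := isProbabilityMeasure_negBinMeasure hr0 (Ioo_subset_Ico_self hp)
  have hmedian : TendstoInMeasure P M atTop
      (fun _ => lowerMedian (uniformJitter (negBinMeasure r p))) :=
    tendstoInMeasure_sampleMedian
      (fun i => hasLaw_add_uniformJitter (h.hasLaw_K i) (h.hasLaw_U i) (h.indep_pair i))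
      h.pairwise_indepFun_add (isMedian_lowerMedian _)
      (fun _ => eq_lowerMedian_uniformJitter (negBinMeasure_singleton_ne_zero hr0 hp)) hM
  refine tendstoInMeasure_const_comp hmedian (continuousAt_robustEstimator ?_)
  linarith [lowerMedian_uniformJitter_nonneg (μ := negBinMeasure r p)]

end IsNegBinUniformSample

theorem mainTheorem6 (p : ℝ) (hp : p ∈ Set.Ioo (0 : ℝ) 1)
    (Ω : ℝ → Type*) [∀ r, MeasurableSpace (Ω r)]
    (P : ∀ r, Measure (Ω r)) [∀ r, IsProbabilityMeasure (P r)]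
    (K : ∀ r, ℕ → Ω r → ℕ) (U : ∀ r, ℕ → Ω r → ℝ)
    (hKU : ∀ r, 0 < r → IsNegBinUniformSample (P r) r p (K r) (U r))
    (M : ∀ r, ℕ → Ω r → ℝ)
    (hM : ∀ r, 0 < r → ∀ (n : ℕ) (ω : Ω r),
      IsSampleMedian (fun i : Fin n => (K r i ω : ℝ) + U r i ω) (M r n ω)) :
    (∃ c : ℝ → ℝ,
      (∀ᶠ r in atTop,
        TendstoInMeasure (P r) (fun n ω => robustEstimator r (M r n ω)) atTop (fun _ => c r)) ∧
      Tendsto c atTop (𝓝 p)) ∧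
    (∀ ε : ℝ, 0 < ε →
      Tendsto
        (fun r => limsup (fun n => P r {ω | ε ≤ |robustEstimator r (M r n ω) - p|}) atTop)
        atTop (𝓝 0)) := by
  have hprob : ∀ᶠ r in atTop, TendstoInMeasure (P r)
      (fun n ω => robustEstimator r (M r n ω)) atTop
      (fun _ => robustEstimator r (lowerMedian (uniformJitter (negBinMeasure r p)))) := by
    filter_upwards [eventually_gt_atTop 1] with r hr
    have hr0 : 0 < r := zero_lt_one.trans hr
    exact (hKU r hr0).tendstoInMeasure_robustEstimator (by linarith) hp (hM r hr0)
  have hlim := tendsto_robustEstimator_lowerMedian (Ioo_subset_Ico_self hp)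
  refine ⟨⟨_, hprob, hlim⟩, fun ε hε => ?_⟩
  simpa [Real.dist_eq] using
    tendsto_limsup_measure_notMem hprob hlim (Metric.ball_mem_nhds p hε)
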